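/- Let $G=\mathbb Z_{N_1}\times\cdots\times\mathbb Z_{N_k}$ with all $N_i\ge 1$, regarded as a ring under componentwise operations, and let $\mathcal X$ be a non-empty set, so that the functions $\mathcal X\to G$ form a $G$-module. Let $\mathcal A$ be a submodule of this module, let $f$ be a group homomorphism from $\mathcal A$ to an arbitrary group, and suppose that $\mathcal B=\ker f$ is a submodule and that the quotient $\mathcal A/\mathcal B$ is realised as a submodule $\mathcal C\subseteq\mathcal A$, i.e. $\mathcal A=\mathcal B\oplus\mathcal C$. Suppose that $\mathcal B$ and $\mathcal C$ are free over $G$ with finite bases $B_1,\dots,B_m$ and $C_1,\dots,C_n$ (so $\mathcal A$ is free too). For $q\ge 0$ and $\mathbf x=(x_1,\dots,x_q)\in\mathcal X^q$ let $\mathbf B(\mathbf x)=(B_\ell(x_i))_{\ell,i}\in G^{m\times q}$ and $\mathbf C(\mathbf x)=(C_j(x_i))_{j,i}\in G^{n\times q}$. A $q$-query quantum algorithm starts in an oracle-independent unit vector, alternates $q$ queries to the oracle $A$ with oracle-independent unitaries, finally measures in the computational basis, and outputs a function of the outcome. A query is either a phase query $|x,\xi,z\rangle\mapsto\xi(A(x))\,|x,\xi,z\rangle$,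 where $x\in\mathcal X$, $\xi$ is a character of $G$ and $z$ belongs to a workspace of arbitrary finite dimension, or a controlled-add query $|x,g,z\rangle\mapsto|x,g+A(x),z\rangle$ with $g\in G$. Its success probability is the probability that it outputs $f(A)$ when $A$ is uniformly distributed on $\mathcal A$. Then, in the phase query model and also in the controlled-add query model, the maximum success probability of a $q$-query quantum algorithm exists (it is attained) and equals \[ \frac{1}{|\mathcal C|}\,\max_{\mathbf h\in G^m}\Bigl|\bigl\{\mathbf C(\mathbf x)\cdot\mathbf r \;:\; \mathbf x\in\mathcal X^q,\ \mathbf r\in G^q,\ \mathbf B(\mathbf x)\cdot\mathbf r=\mathbf h\bigr\}\Bigr| . \] -/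

import Mathlib

/-- The finite abelian group `ℤ_{N_1} × ⋯ × ℤ_{N_k}`; with the componentwise multiplication it is
also the ring of scalars. -/
abbrev OracleRange {k : ℕ} (N : Fin k → ℕ) : Type := ∀ i, ZMod (N i)

namespace QuantumQuery

/-- The Hilbert space `ℓ²(X × K × Fin w)` with orthonormal basis `|x, κ, z⟩`: a query input register
`X`, a query response register `K`, and a workspace of arbitrary finite dimension `w`. -/
abbrev QState (X K : Type*) (w : ℕ) : Type _ := lp (fun _ : X × K × Fin w => ℂ) 2

/-- The controlled-add query to `A`: the unitary `|x, g, z⟩ ↦ |x, g + A x, z⟩`. -/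
noncomputable def addQuery {X G : Type*} [AddCommGroup G] (A : X → G) {w : ℕ}
    (ψ : QState X G w) : QState X G w :=
  ⟨fun b => ψ (b.1, b.2.1 - A b.1, b.2.2), by
    have h := (memℓp_gen_iff (p := 2) (by norm_num)).1 (lp.memℓp ψ)
    refine (memℓp_gen_iff (p := 2) (by norm_num)).2 ?_
    refine h.comp_injective (i := fun b : X × G × Fin w => (b.1, b.2.1 - A b.1, b.2.2)) ?_
    rintro ⟨x, g, z⟩ ⟨x', g', z'⟩ hb
    simp only [Prod.mk.injEq] at hb ⊢
    obtain ⟨rfl, hg, rfl⟩ := hb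
    exact ⟨rfl, sub_left_injective hg, rfl⟩⟩

/-- The phase query to `A`: the unitary `|x, ξ, z⟩ ↦ ξ(A x) |x, ξ, z⟩`, where `ξ` ranges over the
characters of the finite group `G`. -/
noncomputable def phaseQuery {X G : Type*} [AddCommGroup G] [Finite G] (A : X → G) {w : ℕ}
    (ψ : QState X (AddChar G ℂ) w) : QState X (AddChar G ℂ) w :=
  ⟨fun b => b.2.1 (A b.1) * ψ b, by
    have h := (memℓp_gen_iff (p := 2) (by norm_num)).1 (lp.memℓp ψ)
    refine (memℓp_gen_iff (p := 2) (by norm_num)).2 ?_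
    simpa [AddChar.norm_apply] using h⟩

/-- A (sequential) quantum query algorithm with outputs in `H`: a workspace dimension, a unit
initial state, for each `n` the oracle-independent unitary applied after the query number `n`
(counted from `0`), and the classical post-processing of the outcome of the final measurement in the
basis `|x, κ, z⟩`. -/
structure Algorithm (X K H : Type*) where
  w : ℕ
  init : QState X K w
  norm_init : ‖init‖ = 1
  step : ℕ → (QState X K w ≃ₗᵢ[ℂ] QState X K w)
  output : X × K × Fin w → H

namespace Algorithm

variable {X K H : Type*}

/-- The state after `q` queries, a query being answered by the operator `O`. -/
noncomputable def stateAfter (alg : Algorithm X K H) (O : QState X K alg.w → QState X K alg.w) :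
    ℕ → QState X K alg.w
  | 0 => alg.init
  | n + 1 => alg.step n (O (alg.stateAfter O n))

/-- The probability that the final measurement after `q` queries makes the algorithm output `v`. -/
noncomputable def outputProb (alg : Algorithm X K H) (O : QState X K alg.w → QState X K alg.w)
    (q : ℕ) (v : H) : ℝ :=
  ∑' b : {b : X × K × Fin alg.w // alg.output b = v}, ‖alg.stateAfter O q b‖ ^ 2

/-- The probability of outputting `f A` after `q` queries to an oracle `A` drawn uniformly from the
finite set `S` of functions, where `query A` is the query operator of `A`. -/
noncomputable def successProb {G : Type*} (alg : Algorithm X K H)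
    (query : (X → G) → ∀ {w : ℕ}, QState X K w → QState X K w) (S : Set (X → G)) (f : S → H)
    (q : ℕ) : ℝ :=
  (∑ᶠ A : S, alg.outputProb (query A.1) q (f A)) / Nat.card S

end Algorithm

/-- The matrix with entries `F_ℓ(x_i)`. -/
def evalMatrix {X G : Type*} {m q : ℕ} (F : Fin m → X → G) (x : Fin q → X) :
    Matrix (Fin m) (Fin q) G :=
  Matrix.of fun l i => F l (x i)

/-- For given `h`, the set of all vectors `C(x)·r` with `x ∈ X^q`, `r ∈ G^q` and `B(x)·r = h`. -/
def reachable {X G : Type*} [CommRing G] {m n : ℕ} (B : Fin m → X → G) (C : Fin n → X → G)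
    (q : ℕ) (h : Fin m → G) : Set (Fin n → G) :=
  {z | ∃ (x : Fin q → X) (r : Fin q → G),
    z = (evalMatrix C x).mulVec r ∧ (evalMatrix B x).mulVec r = h}

end QuantumQuery

/-! Write the oracle as `A = ∑ b_ℓ B_ℓ + ∑ c_j C_j`, with `(b, c)` uniform on `G^m × G^n`; then `f
A` is an injective function of `c`. A primitive character `e` of `G` writes every character as `g ↦
e (r * g)`, so a phase query multiplies each basis vector by a character of `(b, c)`, with exponent
`(B(x) r, C(x) r)`. Exponents add up over queries. Hence the state after `q` queries is `∑_{h,z} e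
(b·h + c·z) φ_{h,z}`, where the vectors `φ_{h,z}` do not depend on the oracle and vanish unless `z`
is reachable from `h` (`exists_stateAfter_eq`).

Upper bound (`sum_outputProb_le`): summing over `b`, orthogonality of characters separates the
values of `h`. For each `h` at most `M` terms survive, `M` being the largest size of a reachable
set, so Cauchy–Schwarz costs a factor `M`. The projections belonging to different answers `c` are
orthogonal, and `∑ ‖φ_{h,z}‖² = 1`.

Attainment (`exists_le_sum_outputProb`): for an optimal `h` with reachable set `S`, put the
workspace in a uniform superposition over `z ∈ S` and let the queries give branch `z` the phase `e
(b·h + c·z)`. The factor `e (b·h)` is global, and an inverse Fourier transform then yields `c` with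
probability `|S| / |G|^n`.

A controlled-add query is a phase query conjugated by the Fourier transform of the response
register. Both models are therefore treated at once, through a unitary `T` intertwining the query
with `phaseQuery`. -/

namespace QuantumQuery

/-! ### Unitaries and coordinate projections on `ℓ²` -/

section Lp

variable {I J A : Type*}

theorem memlp_two_iff {ψ : I → ℂ} :
    Memℓp (E := fun _ : I => ℂ) ψ 2 ↔ Summable fun i => ‖ψ i‖ ^ 2 := by
  rw [memℓp_gen_iff (by norm_num)]
  simp

theorem summable_norm_sq (ψ : lp (fun _ : I => ℂ) 2) : Summable fun i => ‖ψ i‖ ^ 2 :=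
  memlp_two_iff.1 (lp.memℓp ψ)

theorem norm_sq_eq_tsum (ψ : lp (fun _ : I => ℂ) 2) : ‖ψ‖ ^ 2 = ∑' i, ‖ψ i‖ ^ 2 := by
  have := lp.norm_rpow_eq_tsum (p := 2) (by norm_num) ψ
  simpa using this

theorem norm_eq_of_tsum_eq {ψ : lp (fun _ : I => ℂ) 2} {φ : lp (fun _ : J => ℂ) 2}
    (h : ∑' i, ‖ψ i‖ ^ 2 = ∑' j, ‖φ j‖ ^ 2) : ‖ψ‖ = ‖φ‖ := by
  rw [← norm_sq_eq_tsum, ← norm_sq_eq_tsum] at h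
  exact (sq_eq_sq₀ (norm_nonneg _) (norm_nonneg _)).1 h

/-- Relabelling the basis vectors. -/
noncomputable def reindex (e : I ≃ J) :
    lp (fun _ : I => ℂ) 2 ≃ₗᵢ[ℂ] lp (fun _ : J => ℂ) 2 where
  toFun ψ := ⟨fun j => ψ (e.symm j),
    memlp_two_iff.2 ((summable_norm_sq ψ).comp_injective e.symm.injective)⟩
  invFun ψ := ⟨fun i => ψ (e i), memlp_two_iff.2 ((summable_norm_sq ψ).comp_injective e.injective)⟩
  map_add' _ _ := rfl
  map_smul' _ _ := rfl
  left_inv ψ := by ext; simp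
  right_inv ψ := by ext; simp
  norm_map' ψ := norm_eq_of_tsum_eq (e.symm.tsum_eq fun i => ‖ψ i‖ ^ 2)

theorem reindex_apply (e : I ≃ J) (ψ : lp (fun _ : I => ℂ) 2) (j : J) :
    reindex e ψ j = ψ (e.symm j) := rfl

/-- The projection onto the span of the basis vectors with labels in `s`. -/
noncomputable def mask (s : Set I) : lp (fun _ : I => ℂ) 2 →ₗ[ℂ] lp (fun _ : I => ℂ) 2 where
  toFun ψ := ⟨s.indicator ψ, memlp_two_iff.2 <| (summable_norm_sq ψ).of_nonneg_of_le
    (fun _ => by positivity) fun i => by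
      gcongr
      exact norm_indicator_le_norm_self _ _⟩
  map_add' ψ φ := by
    ext i
    exact congrFun (Set.indicator_add s (ψ : I → ℂ) φ) i
  map_smul' c ψ := by
    ext i
    exact congrFun (Set.indicator_const_smul s c (ψ : I → ℂ)) i

open Classical in
theorem mask_apply (s : Set I) (ψ : lp (fun _ : I => ℂ) 2) (i : I) :
    mask s ψ i = if i ∈ s then ψ i else 0 := by
  change s.indicator ψ i = _
  rw [Set.indicator_apply]

theorem norm_mask_sq (s : Set I) (ψ : lp (fun _ : I => ℂ) 2) :
    ‖mask s ψ‖ ^ 2 = ∑' i : s, ‖ψ i‖ ^ 2 := by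
  classical
  rw [norm_sq_eq_tsum, tsum_subtype s fun i => ‖ψ i‖ ^ 2]
  refine tsum_congr fun i => ?_
  rw [mask_apply, Set.indicator_apply]
  split_ifs <;> simp

theorem sum_norm_mask_sq_le [Fintype A] (s : A → Set I)
    (hs : Pairwise fun a b => Disjoint (s a) (s b))
    (ψ : lp (fun _ : I => ℂ) 2) : ∑ a, ‖mask (s a) ψ‖ ^ 2 ≤ ‖ψ‖ ^ 2 := by
  classical
  simp only [norm_sq_eq_tsum]
  rw [← Summable.tsum_finsetSum fun a _ => summable_norm_sq _]
  refine Summable.tsum_le_tsum (fun i => ?_) (summable_sum fun a _ => summable_norm_sq _)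
    (summable_norm_sq ψ)
  by_cases h : ∃ a, i ∈ s a
  · obtain ⟨a, ha⟩ := h
    rw [Finset.sum_eq_single a]
    · simp [mask_apply, ha]
    · intro b _ hb
      have : i ∉ s b := fun hi => Set.disjoint_left.1 (hs hb) hi ha
      simp [mask_apply, this]
    · simp
  · push Not at h
    rw [Finset.sum_eq_zero]
    · positivity
    · intro a _
      simp [mask_apply, h a]

open Matrix in
theorem star_dotProduct_self [Fintype J] (u : J → ℂ) :
    star u ⬝ᵥ u = ((∑ j, ‖u j‖ ^ 2 : ℝ) : ℂ) := by
  simp [dotProduct, Complex.conj_mul']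

open Matrix in
theorem sum_norm_mulVec_sq [Fintype J] [DecidableEq J] [Fintype A] (M : Matrix A J ℂ)
    (hM : Mᴴ * M = 1) (v : J → ℂ) : ∑ a, ‖(M *ᵥ v) a‖ ^ 2 = ∑ j, ‖v j‖ ^ 2 := by
  have key : star (M *ᵥ v) ⬝ᵥ (M *ᵥ v) = star v ⬝ᵥ v := by
    rw [star_mulVec, ← dotProduct_mulVec, mulVec_mulVec, hM, one_mulVec]
  rw [star_dotProduct_self, star_dotProduct_self] at key
  exact_mod_cast key

open Matrix in
/-- An isometric matrix acting on the second tensor factor. -/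
noncomputable def blockIsometry (I : Type*) [Fintype J] [DecidableEq J] [Fintype A]
    (M : Matrix A J ℂ) (hM : Mᴴ * M = 1) :
    lp (fun _ : I × J => ℂ) 2 →ₗᵢ[ℂ] lp (fun _ : I × A => ℂ) 2 :=
  have key (ψ : lp (fun _ : I × J => ℂ) 2) (i : I) :
      ∑ a, ‖(M *ᵥ fun j => ψ (i, j)) a‖ ^ 2 = ∑ j, ‖ψ (i, j)‖ ^ 2 := sum_norm_mulVec_sq M hM _
  have summ (ψ : lp (fun _ : I × J => ℂ) 2) :
      Summable fun b : I × A => ‖(M *ᵥ fun j => ψ (b.1, j)) b.2‖ ^ 2 := by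
    refine (summable_prod_of_nonneg fun _ => by positivity).2
      ⟨fun i => Summable.of_finite, ?_⟩
    have h := (summable_prod_of_nonneg (f := fun b : I × J => ‖ψ b‖ ^ 2)
      fun _ => by positivity).1 (summable_norm_sq ψ)
    simpa only [tsum_fintype, key] using h.2
  { toFun := fun ψ => ⟨fun b => (M *ᵥ fun j => ψ (b.1, j)) b.2, memlp_two_iff.2 (summ ψ)⟩
    map_add' := fun ψ φ => by
      ext b
      exact congrFun (mulVec_add M (fun j => ψ (b.1, j)) fun j => φ (b.1, j)) b.2
    map_smul' := fun c ψ => by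
      ext b
      exact congrFun (mulVec_smul M c fun j => ψ (b.1, j)) b.2
    norm_map' := fun ψ => by
      refine norm_eq_of_tsum_eq ?_
      rw [(summable_norm_sq ψ).tsum_prod]
      refine (Summable.tsum_prod (summ ψ)).trans (tsum_congr fun i => ?_)
      simpa only [tsum_fintype] using key ψ i }

open Matrix in
theorem blockIsometry_comp (I : Type*) [Fintype J] [DecidableEq J] [Fintype A] [DecidableEq A]
    (M : Matrix A J ℂ) (hM : Mᴴ * M = 1) (L : Matrix J A ℂ) (hL : Lᴴ * L = 1) (hLM : L * M = 1)
    (ψ : lp (fun _ : I × J => ℂ) 2) : blockIsometry I L hL (blockIsometry I M hM ψ) = ψ := by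
  ext b
  change (L *ᵥ (M *ᵥ fun j => ψ (b.1, j))) b.2 = _
  rw [mulVec_mulVec, hLM, one_mulVec]

open Matrix in
/-- A unitary matrix acting on the second tensor factor. -/
noncomputable def blockUnitary (I : Type*) [Fintype J] [DecidableEq J] [Fintype A] [DecidableEq A]
    (M : Matrix A J ℂ) (hM : Mᴴ * M = 1) (hM' : M * Mᴴ = 1) :
    lp (fun _ : I × J => ℂ) 2 ≃ₗᵢ[ℂ] lp (fun _ : I × A => ℂ) 2 :=
  { blockIsometry I M hM with
    invFun := blockIsometry I Mᴴ (by rwa [conjTranspose_conjTranspose])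
    left_inv := blockIsometry_comp I M hM _ _ hM
    right_inv := blockIsometry_comp I Mᴴ _ M hM hM' }

open Matrix in
theorem blockUnitary_apply (I : Type*) [Fintype J] [DecidableEq J] [Fintype A] [DecidableEq A]
    (M : Matrix A J ℂ) (hM : Mᴴ * M = 1) (hM' : M * Mᴴ = 1) (ψ : lp (fun _ : I × J => ℂ) 2)
    (b : I × A) : blockUnitary I M hM hM' ψ b = ∑ j, M b.2 j * ψ (b.1, j) := rfl

end Lp

/-! ### Orthogonality of characters -/

section Characters

variable {A J : Type*} [AddCommGroup A] [Fintype A]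

open ComplexConjugate in
theorem sum_conj_mul_char [DecidableEq J] {χ : J → AddChar A ℂ} (hχ : Function.Injective χ)
    (j j' : J) :
    ∑ a, conj (χ j a) * χ j' a = if j = j' then (Fintype.card A : ℂ) else 0 := by
  classical
  have h : ∀ a, conj (χ j a) * χ j' a = (χ j' - χ j) a := fun a => by
    rw [AddChar.sub_apply, AddChar.map_neg_eq_conj, mul_comm]
  simp_rw [h]
  rw [AddChar.sum_eq_ite]
  simp [sub_eq_zero, hχ.eq_iff, eq_comm]

/-- Parseval with vector coefficients: expand the inner product, and orthogonality kills the cross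
terms. The vectors will be parts of quantum states. -/
theorem sum_norm_sum_char_sq [Fintype J] {E : Type*} [NormedAddCommGroup E] [InnerProductSpace ℂ E]
    {χ : J → AddChar A ℂ} (hχ : Function.Injective χ) (v : J → E) :
    ∑ a, ‖∑ j, χ j a • v j‖ ^ 2 = Fintype.card A * ∑ j, ‖v j‖ ^ 2 := by
  classical
  have h : (∑ a, ((‖∑ j, χ j a • v j‖ : ℝ) : ℂ) ^ 2)
      = Fintype.card A * ∑ j, ((‖v j‖ : ℝ) : ℂ) ^ 2 := by
    have h1 : ∀ x : E, ((‖x‖ : ℝ) : ℂ) ^ 2 = inner ℂ x x := fun x =>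
      (inner_self_eq_norm_sq_to_K (𝕜 := ℂ) x).symm
    simp only [h1]
    simp only [sum_inner, inner_sum, inner_smul_left, inner_smul_right]
    rw [Finset.sum_comm, Finset.mul_sum]
    refine Finset.sum_congr rfl fun j _ => ?_
    simp only [Finset.mul_sum]
    rw [Finset.sum_comm]
    have h2 : ∀ i, ∑ a, χ j a * ((starRingEnd ℂ) (χ i a) * inner ℂ (v i) (v j))
        = (if i = j then (Fintype.card A : ℂ) else 0) * inner ℂ (v i) (v j) := fun i => by
      rw [← sum_conj_mul_char hχ, Finset.sum_mul]
      exact Finset.sum_congr rfl fun a _ => by ring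
    simp only [h2]
    simp
  exact_mod_cast h

/-- The normalised character table. -/
noncomputable def charMatrix (χ : J → AddChar A ℂ) : Matrix A J ℂ :=
  Matrix.of fun a j => χ j a / (Real.sqrt (Fintype.card A) : ℂ)

open Matrix in
theorem charMatrix_conjTranspose_mul [Fintype J] [DecidableEq J] {χ : J → AddChar A ℂ}
    (hχ : Function.Injective χ) : (charMatrix χ)ᴴ * charMatrix χ = 1 := by
  ext j j'
  have hs : ((Real.sqrt (Fintype.card A) : ℝ) : ℂ) * (Real.sqrt (Fintype.card A) : ℝ)
      = Fintype.card A := by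
    rw [← Complex.ofReal_mul, Real.mul_self_sqrt (by positivity)]
    simp
  have hc : (Fintype.card A : ℂ) ≠ 0 := by simp
  simp only [charMatrix, mul_apply, conjTranspose_apply, of_apply, star_div₀, RCLike.star_def,
    Complex.conj_ofReal, div_mul_div_comm, hs, ← Finset.sum_div, sum_conj_mul_char hχ, one_apply]
  split_ifs <;> simp [hc]

open Matrix in
theorem charMatrix_mul_conjTranspose [Fintype J] [DecidableEq A] {χ : J → AddChar A ℂ}
    (hχ : Function.Injective χ) (hJ : Fintype.card J = Fintype.card A) :
    charMatrix χ * (charMatrix χ)ᴴ = 1 := by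
  classical
  exact (Matrix.mul_eq_one_comm_of_card_eq _ _ _ hJ).1 (charMatrix_conjTranspose_mul hχ)

end Characters

end QuantumQuery

namespace QuantumQuery

/-! ### Characters of the coordinate group and reachable exponents -/

section Pairing

variable {G : Type*} [CommRing G] {m n : ℕ}

/-- The character `b ↦ e (b ⬝ᵥ h)` of `ι → G`. -/
def dotChar {ι : Type*} [Fintype ι] (e : AddChar G ℂ) (h : ι → G) : AddChar (ι → G) ℂ where
  toFun b := e (b ⬝ᵥ h)
  map_zero_eq_one' := by simp
  map_add_eq_mul' a b := by rw [add_dotProduct, e.map_add_eq_mul]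

theorem dotChar_apply {ι : Type*} [Fintype ι] (e : AddChar G ℂ) (h b : ι → G) :
    dotChar e h b = e (b ⬝ᵥ h) := rfl

theorem dotChar_injective {ι : Type*} [Fintype ι] {e : AddChar G ℂ} (he : e.IsPrimitive) :
    Function.Injective (dotChar e : (ι → G) → AddChar (ι → G) ℂ) := by
  classical
  intro h h' hh
  ext i
  refine AddChar.to_mulShift_inj_of_isPrimitive he ?_
  ext x
  have := DFunLike.congr_fun hh (Pi.single i x)
  simpa [dotChar_apply, mul_comm] using this

/-- By primitivity `r ↦ e.mulShift r` is injective, and `G` has as many characters as elements. -/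
theorem exists_mulShift_eq [Fintype G] {e : AddChar G ℂ} (he : e.IsPrimitive)
    (ξ : AddChar G ℂ) : ∃ r, e.mulShift r = ξ := by
  classical
  exact ((Fintype.bijective_iff_injective_and_card _).2
    ⟨AddChar.to_mulShift_inj_of_isPrimitive he, AddChar.card_eq.symm⟩).2 ξ

/-- The bicharacter `(b, c), (h, z) ↦ e (b ⬝ᵥ h + c ⬝ᵥ z)`. -/
def pairChar (e : AddChar G ℂ) (a d : (Fin m → G) × (Fin n → G)) : ℂ :=
  dotChar e d.1 a.1 * dotChar e d.2 a.2

theorem pairChar_zero (e : AddChar G ℂ) (a : (Fin m → G) × (Fin n → G)) :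
    pairChar e a 0 = 1 := by
  simp [pairChar, dotChar_apply]

theorem pairChar_add (e : AddChar G ℂ) (a d d' : (Fin m → G) × (Fin n → G)) :
    pairChar e a (d + d') = pairChar e a d * pairChar e a d' := by
  simp only [pairChar, dotChar_apply, Prod.fst_add, Prod.snd_add, dotProduct_add,
    AddChar.map_add_eq_mul]
  ring

variable {X : Type*} (B : Fin m → X → G) (C : Fin n → X → G)

/-- The function with coordinates `a` with respect to the functions `B_ℓ` and `C_j`. -/
def oracle (a : (Fin m → G) × (Fin n → G)) (x : X) : G :=
  a.1 ⬝ᵥ (fun l => B l x) + a.2 ⬝ᵥ fun j => C j x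

/-- The exponents `(h, z)` contributed by the character `g ↦ e (r * g)` at the point `x`. -/
def exponent (x : X) (r : G) : (Fin m → G) × (Fin n → G) :=
  (fun l => B l x * r, fun j => C j x * r)

theorem pairChar_exponent (e : AddChar G ℂ) (a : (Fin m → G) × (Fin n → G)) (x : X) (r : G) :
    pairChar e a (exponent B C x r) = e.mulShift r (oracle B C a x) := by
  simp only [pairChar, dotChar_apply, exponent, oracle, AddChar.mulShift_apply,
    ← AddChar.map_add_eq_mul, dotProduct, mul_add, Finset.mul_sum]
  congr 2 <;> exact Finset.sum_congr rfl fun _ _ => by ring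

/-- Recasts reachability as a sum of one increment per query, the form suited to induction on `q`.
-/
theorem mem_reachable_iff {q : ℕ} {d : (Fin m → G) × (Fin n → G)} :
    d.2 ∈ reachable B C q d.1 ↔
      ∃ (x : Fin q → X) (r : Fin q → G), d = ∑ i, exponent B C (x i) (r i) := by
  have key (x : Fin q → X) (r : Fin q → G) : ∑ i, exponent B C (x i) (r i)
      = ((evalMatrix B x).mulVec r, (evalMatrix C x).mulVec r) := by
    ext i <;>
    simp [exponent, Matrix.mulVec, dotProduct, evalMatrix, Prod.fst_sum, Prod.snd_sum,
      Finset.sum_apply]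
  simp only [key, reachable, Set.mem_ofPred_eq, Prod.ext_iff]
  exact exists_congr fun x => exists_congr fun r => by rw [and_comm, @eq_comm _ d.1]

theorem mem_reachable_succ {q : ℕ} {d : (Fin m → G) × (Fin n → G)}
    (hd : d.2 ∈ reachable B C q d.1) (x : X) (r : G) :
    (d + exponent B C x r).2 ∈ reachable B C (q + 1) (d + exponent B C x r).1 := by
  rw [mem_reachable_iff] at hd ⊢
  obtain ⟨xs, rs, rfl⟩ := hd
  exact ⟨Fin.snoc xs x, Fin.snoc rs r, by simp [Fin.sum_univ_castSucc]⟩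

theorem zero_mem_reachable_zero :
    (0 : (Fin m → G) × (Fin n → G)).2 ∈
      reachable B C 0 (0 : (Fin m → G) × (Fin n → G)).1 :=
  (mem_reachable_iff B C).2 ⟨Fin.elim0, Fin.elim0, by simp⟩

end Pairing

/-! ### Fourier expansion of the state in the oracle coordinates -/

section PhaseQuery

variable {X G : Type*} {w : ℕ}

theorem norm_phaseQuery [AddCommGroup G] [Finite G] (A : X → G)
    (ψ : QState X (AddChar G ℂ) w) : ‖phaseQuery A ψ‖ = ‖ψ‖ := by
  refine norm_eq_of_tsum_eq (tsum_congr fun b => ?_)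
  change ‖b.2.1 (A b.1) * ψ b‖ ^ 2 = _
  rw [norm_mul, AddChar.norm_apply, one_mul]

/-- Each basis vector is an eigenvector of the query; grouping them by exponent isolates the
dependence on the oracle in the scalars `pairChar e a d`. -/
theorem phaseQuery_oracle [CommRing G] [Fintype G] {m n : ℕ} (B : Fin m → X → G)
    (C : Fin n → X → G) (e : AddChar G ℂ) (r : AddChar G ℂ → G) (hr : ∀ ξ, e.mulShift (r ξ) = ξ)
    (a : (Fin m → G) × (Fin n → G)) (ψ : QState X (AddChar G ℂ) w) :
    phaseQuery (oracle B C a) ψ =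
      ∑ d, pairChar e a d • mask {b | exponent B C b.1 (r b.2.1) = d} ψ := by
  classical
  ext b
  rw [lp.coeFn_sum, Finset.sum_apply,
    Finset.sum_eq_single (exponent B C b.1 (r b.2.1))]
  · rw [lp.coeFn_smul, Pi.smul_apply, mask_apply, pairChar_exponent, hr]
    simp [phaseQuery]
  · intro d _ hd
    rw [lp.coeFn_smul, Pi.smul_apply, mask_apply, if_neg, smul_zero]
    exact fun h => hd h.symm
  · simp

theorem mask_eq_zero {I : Type*} {s : Set I} (hs : s = ∅) (ψ : lp (fun _ : I => ℂ) 2) :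
    mask s ψ = 0 := by
  ext i
  simp [mask_apply, hs]

theorem norm_stateAfter [AddCommGroup G] [Finite G] {K H : Type*}
    {query : (X → G) → ∀ {w : ℕ}, QState X K w → QState X K w}
    {T : ∀ w, QState X (AddChar G ℂ) w ≃ₗᵢ[ℂ] QState X K w}
    (hT : ∀ A w (ψ : QState X (AddChar G ℂ) w), query A (T w ψ) = T w (phaseQuery A ψ))
    (alg : Algorithm X K H) (A : X → G) (q : ℕ) : ‖alg.stateAfter (query A) q‖ = 1 := by
  induction q with
  | zero => exact alg.norm_init
  | succ q ih =>
    obtain ⟨ψ, hψ⟩ := (T alg.w).surjective (alg.stateAfter (query A) q)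
    rw [Algorithm.stateAfter, LinearIsometryEquiv.norm_map, ← hψ, hT,
      LinearIsometryEquiv.norm_map, norm_phaseQuery, ← ih, ← hψ, LinearIsometryEquiv.norm_map]

/-- After `q` queries the amplitudes, as functions of the oracle, are combinations of the reachable
characters. -/
theorem exists_stateAfter_eq [CommRing G] [Fintype G] {m n : ℕ} (B : Fin m → X → G)
    (C : Fin n → X → G) {e : AddChar G ℂ} (he : e.IsPrimitive) {K H : Type*}
    {query : (X → G) → ∀ {w : ℕ}, QState X K w → QState X K w}
    {T : ∀ w, QState X (AddChar G ℂ) w ≃ₗᵢ[ℂ] QState X K w}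
    (hT : ∀ A w (ψ : QState X (AddChar G ℂ) w), query A (T w ψ) = T w (phaseQuery A ψ))
    (alg : Algorithm X K H) (q : ℕ) :
    ∃ φ : (Fin m → G) × (Fin n → G) → QState X K alg.w,
      (∀ d, φ d ≠ 0 → d.2 ∈ reachable B C q d.1) ∧
      ∀ a, alg.stateAfter (query (oracle B C a)) q = ∑ d, pairChar e a d • φ d := by
  classical
  induction q with
  | zero =>
    refine ⟨Pi.single 0 alg.init, fun d hd => ?_, fun a => ?_⟩
    · have : d = 0 := by
        by_contra h
        exact hd (Pi.single_eq_of_ne h _)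
      rw [this]
      exact zero_mem_reachable_zero B C
    · rw [Finset.sum_eq_single 0]
      · simp [pairChar_zero, Algorithm.stateAfter]
      · intro d _ hd
        rw [Pi.single_eq_of_ne hd, smul_zero]
      · simp
  | succ q ih =>
    obtain ⟨φ, hφ, hs⟩ := ih
    choose r hr using exists_mulShift_eq he
    set S : (Fin m → G) × (Fin n → G) → Set (X × AddChar G ℂ × Fin alg.w) :=
      fun d => {b | exponent B C b.1 (r b.2.1) = d}
    -- Convolution of exponents: `d` arises from an earlier exponent `d - d'` and the increment `d'`
    -- of the new query.
    refine ⟨fun d => alg.step q (T _ (∑ d', mask (S d') ((T _).symm (φ (d - d'))))),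
      fun d hd => ?_, fun a => ?_⟩
    · obtain ⟨d', -, hd'⟩ : ∃ d' ∈ Finset.univ, mask (S d') ((T _).symm (φ (d - d'))) ≠ 0 := by
        by_contra! h
        refine hd ?_
        simp [Finset.sum_eq_zero h]
      obtain ⟨b, rfl⟩ : (S d').Nonempty := by
        rw [Set.nonempty_iff_ne_empty]
        exact fun h => hd' (mask_eq_zero h _)
      have h := mem_reachable_succ B C
        (hφ (d - exponent B C b.1 (r b.2.1)) fun h => hd' (by simp [h])) b.1 (r b.2.1)
      simpa using h
    · have key : phaseQuery (oracle B C a) ((T _).symm (alg.stateAfter (query (oracle B C a)) q))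
          = ∑ d, pairChar e a d • ∑ d', mask (S d') ((T _).symm (φ (d - d'))) := by
        rw [phaseQuery_oracle B C e r hr, hs]
        simp only [map_sum, map_smul, Finset.smul_sum, smul_smul]
        rw [Finset.sum_comm (s := Finset.univ) (t := Finset.univ)
          (f := fun d d' => pairChar e a d • mask (S d') ((T _).symm (φ (d - d'))))]
        refine Finset.sum_congr rfl fun d' _ => ?_
        refine Fintype.sum_equiv (Equiv.addRight d') _ _ fun d => ?_
        simp only [Equiv.coe_addRight, add_sub_cancel_right, pairChar_add]
        rw [mul_comm]
      rw [Algorithm.stateAfter, ← (T _).apply_symm_apply (alg.stateAfter _ q), hT, key]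
      simp only [map_sum, map_smul]

end PhaseQuery

/-! ### The upper bound -/

section UpperBound

variable {X G K H : Type*}

theorem norm_sum_sq_le {ι E : Type*} [Fintype ι] [SeminormedAddCommGroup E] (s : Finset ι)
    (v : ι → E) (hv : ∀ i, i ∉ s → v i = 0) : ‖∑ i, v i‖ ^ 2 ≤ s.card * ∑ i, ‖v i‖ ^ 2 := by
  rw [← Finset.sum_subset s.subset_univ fun i _ hi => hv i hi,
    ← Finset.sum_subset s.subset_univ (f := fun i => ‖v i‖ ^ 2) fun i _ hi => by simp [hv i hi]]
  calc ‖∑ i ∈ s, v i‖ ^ 2 ≤ (∑ i ∈ s, ‖v i‖) ^ 2 := by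
        gcongr
        exact norm_sum_le _ _
    _ ≤ _ := sq_sum_le_card_mul_sum_sq

/-- Parseval in `b` alone, with `c` fixed: different `h` decouple while the `z` still interfere. -/
theorem sum_norm_pairChar_sum_sq [CommRing G] [Fintype G] {m n : ℕ} {e : AddChar G ℂ}
    (he : e.IsPrimitive) {E : Type*} [NormedAddCommGroup E] [InnerProductSpace ℂ E]
    (c : Fin n → G) (v : (Fin m → G) × (Fin n → G) → E) :
    ∑ b : Fin m → G, ‖∑ d, pairChar e (b, c) d • v d‖ ^ 2 =
      Fintype.card (Fin m → G) * ∑ h, ‖∑ z, dotChar e z c • v (h, z)‖ ^ 2 := by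
  rw [← sum_norm_sum_char_sq (dotChar_injective he)]
  simp only [Fintype.sum_prod_type, pairChar, Finset.smul_sum, smul_smul]

theorem sum_outputProb_le [CommRing G] [Fintype G] {m n : ℕ} (B : Fin m → X → G)
    (C : Fin n → X → G) {e : AddChar G ℂ} (he : e.IsPrimitive)
    {query : (X → G) → ∀ {w : ℕ}, QState X K w → QState X K w}
    {T : ∀ w, QState X (AddChar G ℂ) w ≃ₗᵢ[ℂ] QState X K w}
    (hT : ∀ A w (ψ : QState X (AddChar G ℂ) w), query A (T w ψ) = T w (phaseQuery A ψ))
    (alg : Algorithm X K H) (q : ℕ) {F : (Fin n → G) → H} (hF : Function.Injective F) :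
    ∑ a : (Fin m → G) × (Fin n → G), alg.outputProb (query (oracle B C a)) q (F a.2) ≤
      Fintype.card (Fin m → G) *
        ((Finset.univ.sup fun h => (reachable B C q h).ncard : ℕ) : ℝ) := by
  classical
  obtain ⟨φ, hφ, hs⟩ := exists_stateAfter_eq B C he hT alg q
  set M : ℕ := Finset.univ.sup fun h => (reachable B C q h).ncard
  set S : (Fin n → G) → Set (X × K × Fin alg.w) := fun c => {b | alg.output b = F c}
  have hS : Pairwise fun c c' => Disjoint (S c) (S c') := fun c c' hcc =>
    Set.disjoint_left.2 fun b hb hb' => hcc (hF (hb.symm.trans hb'))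
  have hout (a) : alg.outputProb (query (oracle B C a)) q (F a.2)
      = ‖∑ d, pairChar e a d • mask (S a.2) (φ d)‖ ^ 2 := by
    have : ∑ d, pairChar e a d • mask (S a.2) (φ d)
        = mask (S a.2) (alg.stateAfter (query (oracle B C a)) q) := by
      rw [hs]
      simp only [map_sum, map_smul]
    rw [this, norm_mask_sq]
    rfl
  -- All states are unit vectors; summing their squared norms over all oracles and applying Parseval
  -- in `b` and then in `c` gives `∑ ‖φ d‖ ^ 2 = 1`, here with a common factor.
  have htotal : (Fintype.card (Fin n → G) : ℝ) * ∑ d, ‖φ d‖ ^ 2 = Fintype.card (Fin n → G) := by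
    have h1 : ∑ c : Fin n → G, ∑ b : Fin m → G,
        ‖∑ d, pairChar e (b, c) d • φ d‖ ^ 2
        = Fintype.card (Fin n → G) * Fintype.card (Fin m → G) := by
      simp only [← hs, norm_stateAfter hT]
      simp
    simp only [sum_norm_pairChar_sum_sq he, ← Finset.mul_sum] at h1
    rw [Finset.sum_comm] at h1
    simp only [sum_norm_sum_char_sq (dotChar_injective he), ← Finset.mul_sum] at h1
    rw [← Fintype.sum_prod_type' (f := fun h z => ‖φ (h, z)‖ ^ 2)] at h1
    have hm : (Fintype.card (Fin m → G) : ℝ) ≠ 0 := by simp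
    refine mul_left_cancel₀ hm ?_
    linarith
  -- Cauchy–Schwarz over the reachable `z`, the only ones with `φ (h, z) ≠ 0`.
  have hcs (c : Fin n → G) (h : Fin m → G) :
      ‖∑ z, dotChar e z c • mask (S c) (φ (h, z))‖ ^ 2
        ≤ M * ∑ z, ‖mask (S c) (φ (h, z))‖ ^ 2 := by
    have h1 := norm_sum_sq_le (reachable B C q h).toFinite.toFinset
      (fun z => dotChar e z c • mask (S c) (φ (h, z))) fun z hz => by
        have : φ (h, z) = 0 := by
          by_contra h0
          exact hz (by simpa using hφ _ h0)
        simp [this]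
    simp only [norm_smul, AddChar.norm_apply, one_mul] at h1
    refine h1.trans ?_
    gcongr
    rw [← Set.ncard_eq_toFinset_card]
    exact Finset.le_sup (f := fun h => (reachable B C q h).ncard) (Finset.mem_univ h)
  have hn : (Fintype.card (Fin n → G) : ℝ) ≠ 0 := by simp
  calc ∑ a : (Fin m → G) × (Fin n → G), alg.outputProb (query (oracle B C a)) q (F a.2)
      = ∑ c, ∑ b, ‖∑ d, pairChar e (b, c) d • mask (S c) (φ d)‖ ^ 2 := by
        simp only [hout]
        rw [Fintype.sum_prod_type, Finset.sum_comm]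
    _ = Fintype.card (Fin m → G) *
          ∑ c, ∑ h, ‖∑ z, dotChar e z c • mask (S c) (φ (h, z))‖ ^ 2 := by
        simp only [sum_norm_pairChar_sum_sq he, Finset.mul_sum]
    _ ≤ Fintype.card (Fin m → G) * ∑ c, ∑ h, (M * ∑ z, ‖mask (S c) (φ (h, z))‖ ^ 2) := by
        gcongr
        exact hcs _ _
    _ = Fintype.card (Fin m → G) * (M * ∑ d, ∑ c, ‖mask (S c) (φ d)‖ ^ 2) := by
        congr 1
        rw [Finset.sum_comm (s := Finset.univ) (t := Finset.univ)
          (f := fun d c => ‖mask (S c) (φ d)‖ ^ 2)]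
        simp only [Fintype.sum_prod_type, Finset.mul_sum]
    _ ≤ Fintype.card (Fin m → G) * (M * ∑ d, ‖φ d‖ ^ 2) := by
        gcongr
        exact sum_norm_mask_sq_le S hS _
    _ = Fintype.card (Fin m → G) * M := by
        rw [(mul_eq_left₀ hn).1 htotal, mul_one]

end UpperBound

end QuantumQuery

namespace QuantumQuery

/-! ### States whose query registers are determined by the workspace label -/

section Ket

variable {X K : Type*} {w : ℕ}

open Classical in
/-- The superposition `∑ z, a z • |p z, z⟩`. -/
noncomputable def ket (p : Fin w → X × K) (a : Fin w → ℂ) : QState X K w :=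
  ⟨fun b => if (b.1, b.2.1) = p b.2.2 then a b.2.2 else 0, by
    refine memlp_two_iff.2 (summable_of_hasFiniteSupport ?_)
    refine (Set.finite_range fun z => ((p z).1, (p z).2, z)).subset fun b hb => ?_
    by_cases h : (b.1, b.2.1) = p b.2.2
    · exact ⟨b.2.2, by simp [← h]⟩
    · simp [h] at hb⟩

open Classical in
theorem ket_apply (p : Fin w → X × K) (a : Fin w → ℂ) (b : X × K × Fin w) :
    ket p a b = if (b.1, b.2.1) = p b.2.2 then a b.2.2 else 0 := rfl

theorem norm_ket_sq (p : Fin w → X × K) (a : Fin w → ℂ) : ‖ket p a‖ ^ 2 = ∑ z, ‖a z‖ ^ 2 := by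
  classical
  have hinj : Function.Injective fun z => ((p z).1, (p z).2, z) := fun z z' h => by
    simp only [Prod.mk.injEq] at h
    exact h.2.2
  rw [norm_sq_eq_tsum, ← hinj.tsum_eq, tsum_fintype]
  · exact Finset.sum_congr rfl fun z _ => by simp [ket_apply]
  · intro b hb
    by_cases h : (b.1, b.2.1) = p b.2.2
    · exact ⟨b.2.2, by simp [← h]⟩
    · simp [ket_apply, h] at hb

theorem phaseQuery_ket {G : Type*} [AddCommGroup G] [Finite G] (A : X → G)
    (p : Fin w → X × AddChar G ℂ) (a : Fin w → ℂ) :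
    phaseQuery A (ket p a) = ket p fun z => (p z).2 (A (p z).1) * a z := by
  ext b
  change b.2.1 (A b.1) * ket p a b = _
  rw [ket_apply, ket_apply]
  split_ifs with h
  · rw [← h]
  · simp

open Classical in
/-- For each `z`, exchanges the basis vectors `|p z, z⟩` and `|p' z, z⟩`. -/
noncomputable def swapPerm (p p' : Fin w → X × K) : Equiv.Perm (X × K × Fin w) :=
  (Equiv.prodAssoc X K (Fin w)).symm.trans <|
    ((Equiv.prodComm _ _).trans <|
      (Equiv.prodShear (Equiv.refl _) fun z => Equiv.swap (p z) (p' z)).trans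
        (Equiv.prodComm _ _)).trans (Equiv.prodAssoc X K (Fin w))

theorem reindex_swapPerm_ket (p p' : Fin w → X × K) (a : Fin w → ℂ) :
    reindex (swapPerm p p') (ket p a) = ket p' a := by
  classical
  ext ⟨x, κ, z⟩
  rw [reindex_apply, ket_apply, ket_apply]
  simp only [swapPerm, Equiv.symm_trans_apply, Equiv.symm_symm, Equiv.prodAssoc_apply,
    Equiv.prodAssoc_symm_apply, Equiv.prodComm_symm, Equiv.prodComm_apply, Prod.swap,
    Equiv.prodShear_symm_apply, Equiv.refl_symm, Equiv.refl_apply, Equiv.symm_swap, Prod.mk.eta]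
  simp only [Equiv.swap_apply_eq_iff, Equiv.swap_apply_left]

end Ket

/-! ### An optimal algorithm -/

section Attained

variable {X G K H : Type*} [CommRing G] {m n : ℕ}

theorem exists_phases_of_mem_reachable (B : Fin m → X → G) (C : Fin n → X → G)
    (e : AddChar G ℂ) {q : ℕ} {h : Fin m → G} {z : Fin n → G} (hz : z ∈ reachable B C q h)
    (p₀ : X × AddChar G ℂ) :
    ∃ p : ℕ → X × AddChar G ℂ, p q = p₀ ∧
      ∀ a, ∏ i ∈ Finset.range q, (p i).2 (oracle B C a (p i).1) = pairChar e a (h, z) := by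
  classical
  obtain ⟨x, r, hd⟩ := (mem_reachable_iff B C (d := (h, z))).1 hz
  -- From time `q` on the query registers rest at `p₀`, the same for every `z`; they are then
  -- disentangled from the workspace and the branches can interfere.
  refine ⟨fun i => if hi : i < q then (x ⟨i, hi⟩, e.mulShift (r ⟨i, hi⟩)) else p₀, by simp,
    fun a => ?_⟩
  have hprod (s : Finset (Fin q)) : pairChar e a (∑ i ∈ s, exponent B C (x i) (r i))
      = ∏ i ∈ s, e.mulShift (r i) (oracle B C a (x i)) := by
    induction s using Finset.induction_on with
    | empty => simp [pairChar_zero]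
    | insert i s hi ih =>
      rw [Finset.sum_insert hi, Finset.prod_insert hi, pairChar_add, ih, pairChar_exponent]
  rw [hd, hprod, ← Fin.prod_univ_eq_prod_range
    (fun i => (if hi : i < q then (x ⟨i, hi⟩, e.mulShift (r ⟨i, hi⟩)) else p₀).2
      (oracle B C a (if hi : i < q then (x ⟨i, hi⟩, e.mulShift (r ⟨i, hi⟩)) else p₀).1))]
  simp

/-- The unitary which, on the workspace with labels `ε z`, applies the inverse Fourier transform. -/
noncomputable def workspaceFourier [Fintype G] {e : AddChar G ℂ} (he : e.IsPrimitive) {w : ℕ}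
    (ε : Fin w ≃ (Fin n → G)) (R : AddChar G ℂ ≃ K) :
    QState X (AddChar G ℂ) w ≃ₗᵢ[ℂ] QState X K w :=
  letI := Classical.decEq (Fin n → G)
  have hχ : Function.Injective fun j => dotChar e (-ε j) :=
    (dotChar_injective he).comp (neg_injective.comp ε.injective)
  ((reindex (Equiv.prodAssoc X (AddChar G ℂ) (Fin w)).symm).trans
    (blockUnitary (X × AddChar G ℂ) (charMatrix fun j => dotChar e (-ε j))
      (charMatrix_conjTranspose_mul hχ)
      (charMatrix_mul_conjTranspose hχ (Fintype.card_congr ε)))).trans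
    (reindex ((Equiv.prodAssoc X (AddChar G ℂ) (Fin n → G)).trans
      (Equiv.prodCongr (Equiv.refl X) (Equiv.prodCongr R ε.symm))))

theorem workspaceFourier_ket [Fintype G] {e : AddChar G ℂ} (he : e.IsPrimitive) {w : ℕ}
    (ε : Fin w ≃ (Fin n → G)) (R : AddChar G ℂ ≃ K) (p₀ : X × AddChar G ℂ) (a : Fin w → ℂ)
    (c : Fin n → G) :
    workspaceFourier he ε R (ket (fun _ => p₀) a) (p₀.1, R p₀.2, ε.symm c) =
      ∑ z, dotChar e (-ε z) c / (Real.sqrt (Fintype.card (Fin n → G)) : ℂ) * a z := by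
  classical
  simp only [workspaceFourier, LinearIsometryEquiv.trans_apply]
  rw [reindex_apply, blockUnitary_apply]
  refine Finset.sum_congr rfl fun z _ => ?_
  rw [reindex_apply, ket_apply]
  simp [charMatrix]

theorem exists_le_sum_outputProb [Fintype G] [Nonempty X] (B : Fin m → X → G) (C : Fin n → X → G)
    {e : AddChar G ℂ} (he : e.IsPrimitive)
    {query : (X → G) → ∀ {w : ℕ}, QState X K w → QState X K w}
    {T : ∀ w, QState X (AddChar G ℂ) w ≃ₗᵢ[ℂ] QState X K w}
    (hT : ∀ A w (ψ : QState X (AddChar G ℂ) w), query A (T w ψ) = T w (phaseQuery A ψ))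
    (R : AddChar G ℂ ≃ K) (q : ℕ) (F : (Fin n → G) → H) :
    ∃ alg : Algorithm X K H, Fintype.card (Fin m → G) *
        ((Finset.univ.sup fun h => (reachable B C q h).ncard : ℕ) : ℝ) ≤
      ∑ a : (Fin m → G) × (Fin n → G), alg.outputProb (query (oracle B C a)) q (F a.2) := by
  classical
  obtain ⟨h, -, hh⟩ := Finset.exists_mem_eq_sup (Finset.univ : Finset (Fin m → G))
    Finset.univ_nonempty fun h => (reachable B C q h).ncard
  set S : Finset (Fin n → G) := (reachable B C q h).toFinite.toFinset with hS
  have hcard : (Finset.univ.sup fun h => (reachable B C q h).ncard) = S.card := by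
    rw [hh, hS, Set.ncard_eq_toFinset_card]
  -- Taking `r = 0` shows `0` reachable from `h = 0`, so the maximum is positive and the initial
  -- state can be normalised.
  have hpos : (0 : ℝ) < S.card := by
    have h0 : (0 : Fin n → G) ∈ reachable B C q 0 :=
      (mem_reachable_iff B C (d := 0)).2
        ⟨fun _ => Classical.arbitrary X, 0, by simp [exponent, Prod.ext_iff, funext_iff]⟩
    have h1 : (reachable B C q 0).ncard ≤ S.card := by
      rw [← hcard]
      exact Finset.le_sup (f := fun h => (reachable B C q h).ncard) (Finset.mem_univ 0)
    have h2 : 0 < (reachable B C q 0).ncard := (Set.ncard_pos (Set.toFinite _)).2 ⟨0, h0⟩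
    exact_mod_cast h2.trans_le h1
  set p₀ : X × AddChar G ℂ := (Classical.arbitrary X, 0)
  have hp (z : Fin n → G) : ∃ p : ℕ → X × AddChar G ℂ, p q = p₀ ∧ (z ∈ S →
      ∀ a, ∏ i ∈ Finset.range q, (p i).2 (oracle B C a (p i).1) = pairChar e a (h, z)) := by
    by_cases hz : z ∈ S
    · obtain ⟨p, hp, hp'⟩ := exists_phases_of_mem_reachable B C e
        (show z ∈ reachable B C q h by simpa [hS] using hz) p₀
      exact ⟨p, hp, fun _ => hp'⟩
    · exact ⟨fun _ => p₀, rfl, fun h => absurd h hz⟩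
  choose p hpq hpS using hp
  set w := Fintype.card (Fin n → G)
  set ε : Fin w ≃ (Fin n → G) := (Fintype.equivFin _).symm
  set init : Fin w → ℂ := fun z => if ε z ∈ S then 1 / (Real.sqrt S.card : ℂ) else 0
  -- `T` prepares each of the `q` queries; at time `q` the final Fourier transform takes its place.
  -- Later times play no role.
  set V : ℕ → (QState X (AddChar G ℂ) w ≃ₗᵢ[ℂ] QState X K w) :=
    fun i => if i = q then workspaceFourier he ε R else T w
  have hinit : ‖ket (fun z => p (ε z) 0) init‖ = 1 := by
    have h1 : ‖ket (fun z => p (ε z) 0) init‖ ^ 2 = 1 := by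
      rw [norm_ket_sq]
      rw [Fintype.sum_equiv ε _ (fun z => if z ∈ S then 1 / (S.card : ℝ) else 0)]
      · simp [hpos.ne']
      · intro z
        simp only [init]
        split_ifs
        · simp [abs_of_nonneg, Real.sqrt_nonneg, Real.sq_sqrt hpos.le]
        · simp
    exact (pow_eq_one_iff_of_nonneg (norm_nonneg _) two_ne_zero).1 h1
  let alg : Algorithm X K H :=
    { w := w
      init := V 0 (ket (fun z => p (ε z) 0) init)
      norm_init := by rw [LinearIsometryEquiv.norm_map, hinit]
      step := fun i => ((T w).symm.trans
        (reindex (swapPerm (fun z => p (ε z) i) fun z => p (ε z) (i + 1)))).trans (V (i + 1))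
      output := fun b => F (ε b.2.2) }
  have hstate (A : X → G) (i : ℕ) (hi : i ≤ q) : alg.stateAfter (query A) i =
      V i (ket (fun z => p (ε z) i)
        fun z => (∏ j ∈ Finset.range i, (p (ε z) j).2 (A (p (ε z) j).1)) * init z) := by
    induction i with
    | zero => simp [Algorithm.stateAfter, alg]
    | succ i ih =>
      have hV : V i = T w := if_neg (by omega)
      rw [Algorithm.stateAfter, ih (by omega), hV, hT, phaseQuery_ket]
      change V (i + 1) (reindex _ ((T w).symm (T w _))) = _
      rw [LinearIsometryEquiv.symm_apply_apply, reindex_swapPerm_ket]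
      congr 2
      ext z
      rw [Finset.prod_range_succ]
      ring
  refine ⟨alg, ?_⟩
  -- The bound holds for each oracle separately, already from the single outcome `b₀` labelled by
  -- the true `c`.
  have hout (a : (Fin m → G) × (Fin n → G)) : (S.card : ℝ) / w ≤
      alg.outputProb (query (oracle B C a)) q (F a.2) := by
    let b₀ : {b : X × K × Fin alg.w // alg.output b = F a.2} :=
      ⟨(p₀.1, R p₀.2, ε.symm a.2), by simp [alg]⟩
    have h1 : ‖alg.stateAfter (query (oracle B C a)) q b₀.1‖ ^ 2 ≤
        alg.outputProb (query (oracle B C a)) q (F a.2) :=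
      ((summable_norm_sq (alg.stateAfter (query (oracle B C a)) q)).subtype
        {b | alg.output b = F a.2}).le_tsum b₀ fun _ _ => sq_nonneg _
    refine le_trans (le_of_eq ?_) h1
    -- At the true `c` the Fourier phases cancel: `S.card` equal terms add up, each `1 / (√S.card *
    -- √w)` up to the global phase.
    have h2 : alg.stateAfter (query (oracle B C a)) q b₀.1 =
        dotChar e h a.1 * (S.card / (Real.sqrt S.card * Real.sqrt w) : ℝ) := by
      rw [hstate _ q le_rfl]
      simp only [V, if_true, hpq, b₀]
      rw [workspaceFourier_ket, Fintype.sum_equiv ε _ (fun z => if z ∈ S then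
        dotChar e h a.1 * (1 / (Real.sqrt S.card * Real.sqrt w) : ℝ) else 0)]
      · rw [Finset.sum_ite_mem, Finset.univ_inter, Finset.sum_const, nsmul_eq_mul]
        push_cast
        ring
      · intro z
        simp only [init]
        split_ifs with hz
        · have h3 : dotChar e (-ε z) a.2 * dotChar e (ε z) a.2 = 1 := by
            rw [dotChar_apply, dotChar_apply, ← AddChar.map_add_eq_mul]
            simp
          rw [hpS _ hz, pairChar]
          push_cast
          linear_combination (dotChar e h a.1 / (Real.sqrt S.card * Real.sqrt w)) * h3
        · simp
    have hw : (0 : ℝ) < w := by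
      have : 0 < w := Fintype.card_pos
      exact_mod_cast this
    rw [h2, norm_mul, AddChar.norm_apply, one_mul, Complex.norm_real, Real.norm_eq_abs, sq_abs,
      div_pow, mul_pow, Real.sq_sqrt hpos.le, Real.sq_sqrt hw.le]
    field_simp
  calc (Fintype.card (Fin m → G) : ℝ) *
        ((Finset.univ.sup fun h => (reachable B C q h).ncard : ℕ) : ℝ)
      = ∑ a : (Fin m → G) × (Fin n → G), (S.card : ℝ) / w := by
        have hw : (w : ℝ) ≠ 0 := by
          have : 0 < w := Fintype.card_pos
          exact_mod_cast this.ne'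
        rw [hcard, Finset.sum_const, Finset.card_univ, Fintype.card_prod, nsmul_eq_mul]
        push_cast
        change _ = (_ * (w : ℝ)) * _
        field_simp
    _ ≤ _ := Finset.sum_le_sum fun a _ => hout a

end Attained

end QuantumQuery

namespace QuantumQuery

/-! ### Controlled-add queries as conjugated phase queries -/

section AddQuery

variable {X G : Type*} [AddCommGroup G] [Fintype G]

/-- The exchange of the response register and the workspace. -/
def responseLast (X K : Type*) (w : ℕ) : X × K × Fin w ≃ (X × Fin w) × K where
  toFun b := ((b.1, b.2.2), b.2.1)
  invFun b := (b.1.1, b.2, b.1.2)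

/-- The inverse Fourier transform of the response register. -/
noncomputable def responseFourier (X G : Type*) [AddCommGroup G] [Fintype G] (w : ℕ) :
    QState X (AddChar G ℂ) w ≃ₗᵢ[ℂ] QState X G w :=
  letI := Classical.decEq G
  ((reindex (responseLast X (AddChar G ℂ) w)).trans
    (blockUnitary (X × Fin w) (charMatrix fun ξ : AddChar G ℂ => -ξ)
      (charMatrix_conjTranspose_mul neg_injective)
      (charMatrix_mul_conjTranspose neg_injective AddChar.card_eq))).trans
    (reindex (responseLast X G w).symm)

theorem responseFourier_apply {w : ℕ} (ψ : QState X (AddChar G ℂ) w) (b : X × G × Fin w) :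
    responseFourier X G w ψ b =
      ∑ ξ, (-ξ) b.2.1 / (Real.sqrt (Fintype.card G) : ℂ) * ψ (b.1, ξ, b.2.2) := rfl

/-- Translation acts diagonally on Fourier modes: `(-ξ) (g - A x) = (-ξ) g * ξ (A x)`. -/
theorem addQuery_responseFourier (A : X → G) (w : ℕ) (ψ : QState X (AddChar G ℂ) w) :
    addQuery A (responseFourier X G w ψ) = responseFourier X G w (phaseQuery A ψ) := by
  ext b
  rw [responseFourier_apply]
  change responseFourier X G w ψ (b.1, b.2.1 - A b.1, b.2.2) = _
  rw [responseFourier_apply]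
  refine Finset.sum_congr rfl fun ξ _ => ?_
  change _ = _ * (ξ (A b.1) * ψ (b.1, ξ, b.2.2))
  have h : (-ξ) (b.2.1 - A b.1) = (-ξ) b.2.1 * ξ (A b.1) := by
    rw [sub_eq_add_neg, AddChar.map_add_eq_mul, AddChar.neg_apply ξ (-A b.1), neg_neg]
  rw [h]
  ring

end AddQuery

/-! ### From the submodules to coordinates -/

section Coordinates

variable {X G H : Type*} [CommRing G] [AddGroup H] {𝒜 ℬ 𝒞 : Submodule G (X → G)} {m n : ℕ}

theorem oracle_eq (B : Module.Basis (Fin m) G ℬ) (C : Module.Basis (Fin n) G 𝒞)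
    (a : (Fin m → G) × (Fin n → G)) :
    oracle (fun l => (B l : X → G)) (fun j => (C j : X → G)) a =
      (B.equivFun.symm a.1 : X → G) + (C.equivFun.symm a.2 : X → G) := by
  ext x
  simp [oracle, dotProduct, Module.Basis.equivFun_symm_apply, Finset.sum_apply]

theorem oracle_bijOn (hdisj : Disjoint ℬ 𝒞) (hsup : ℬ ⊔ 𝒞 = 𝒜)
    (B : Module.Basis (Fin m) G ℬ) (C : Module.Basis (Fin n) G 𝒞) :
    Set.BijOn (oracle (fun l => (B l : X → G)) fun j => (C j : X → G)) Set.univ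
      (𝒜 : Set (X → G)) := by
  refine ⟨fun a _ => ?_, fun a _ a' _ h => ?_, fun A hA => ?_⟩
  · rw [oracle_eq, ← hsup]
    exact Submodule.add_mem_sup (B.equivFun.symm a.1).2 (C.equivFun.symm a.2).2
  · rw [oracle_eq, oracle_eq, add_comm (B.equivFun.symm a'.1 : X → G),
      ← sub_eq_sub_iff_add_eq_add] at h
    have hB := ℬ.sub_mem (B.equivFun.symm a.1).2 (B.equivFun.symm a'.1).2
    have hC := 𝒞.sub_mem (C.equivFun.symm a'.2).2 (C.equivFun.symm a.2).2
    have h0 := Submodule.disjoint_def.1 hdisj _ hB (h ▸ hC)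
    have h0' := h.symm.trans h0
    rw [sub_eq_zero] at h0 h0'
    exact Prod.ext (B.equivFun.symm.injective (Subtype.ext h0))
      (C.equivFun.symm.injective (Subtype.ext h0'.symm))
  · rw [SetLike.mem_coe, ← hsup, Submodule.mem_sup] at hA
    obtain ⟨b, hb, c, hc, rfl⟩ := hA
    exact ⟨(B.equivFun ⟨b, hb⟩, C.equivFun ⟨c, hc⟩), trivial, by simp [oracle_eq]⟩

theorem isGreatest_successProb [Fintype G] {e : AddChar G ℂ} (he : e.IsPrimitive) {K : Type*}
    {query : (X → G) → ∀ {w : ℕ}, QState X K w → QState X K w}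
    {T : ∀ w, QState X (AddChar G ℂ) w ≃ₗᵢ[ℂ] QState X K w}
    (hT : ∀ A w (ψ : QState X (AddChar G ℂ) w), query A (T w ψ) = T w (phaseQuery A ψ))
    (R : AddChar G ℂ ≃ K) [Nonempty X] (f : 𝒜 →+ H)
    (hker : ∀ A : 𝒜, f A = 0 ↔ (A : X → G) ∈ ℬ) (hdisj : Disjoint ℬ 𝒞) (hsup : ℬ ⊔ 𝒞 = 𝒜)
    (B : Module.Basis (Fin m) G ℬ) (C : Module.Basis (Fin n) G 𝒞) (q : ℕ) :
    IsGreatest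
      {p : ℝ | ∃ alg : Algorithm X K H, p = alg.successProb query (𝒜 : Set (X → G)) f q}
      (1 / (Nat.card 𝒞 : ℝ) *
        ((Finset.univ.sup fun h : Fin m → G =>
          (reachable (fun l => (B l : X → G)) (fun j => (C j : X → G)) q h).ncard : ℕ) : ℝ)) := by
  classical
  set M : ℕ := Finset.univ.sup fun h : Fin m → G =>
    (reachable (fun l => (B l : X → G)) (fun j => (C j : X → G)) q h).ncard
  have hB𝒜 : ℬ ≤ 𝒜 := hsup ▸ le_sup_left
  have hC𝒜 : 𝒞 ≤ 𝒜 := hsup ▸ le_sup_right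
  let Φ : (Fin m → G) × (Fin n → G) ≃ (𝒜 : Set (X → G)) :=
    (Equiv.Set.univ _).symm.trans (Set.BijOn.equiv _ (oracle_bijOn hdisj hsup B C))
  have hΦ (a) : (Φ a : X → G) = oracle (fun l => (B l : X → G)) (fun j => (C j : X → G)) a := rfl
  set F : (Fin n → G) → H := fun c => f (Submodule.inclusion hC𝒜 (C.equivFun.symm c))
  have hfΦ (a) : f (Φ a) = F a.2 := by
    have h1 : (Φ a : 𝒜) = Submodule.inclusion hB𝒜 (B.equivFun.symm a.1) +
        Submodule.inclusion hC𝒜 (C.equivFun.symm a.2) := Subtype.ext ((hΦ a).trans (oracle_eq B C a))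
    have h2 : f (Submodule.inclusion hB𝒜 (B.equivFun.symm a.1)) = 0 :=
      (hker _).2 (B.equivFun.symm a.1).2
    rw [h1, map_add, h2, zero_add]
  -- `f` is injective on `𝒞`, since its kernel `ℬ` meets `𝒞` only in `0`.
  have hF : Function.Injective F := fun c c' h => by
    have h1 : f (Submodule.inclusion hC𝒜 (C.equivFun.symm c - C.equivFun.symm c')) = 0 := by
      rw [map_sub, map_sub, sub_eq_zero]
      exact h
    have h2 := Submodule.disjoint_def.1 hdisj _ ((hker _).1 h1)
      (C.equivFun.symm c - C.equivFun.symm c').2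
    exact C.equivFun.symm.injective (sub_eq_zero.1 (Subtype.ext h2))
  have hsucc (alg : Algorithm X K H) : alg.successProb query (𝒜 : Set (X → G)) f q =
      (∑ a : (Fin m → G) × (Fin n → G), alg.outputProb
        (query (oracle (fun l => (B l : X → G)) (fun j => (C j : X → G)) a)) q (F a.2)) /
      (Fintype.card (Fin m → G) * Fintype.card (Fin n → G)) := by
    rw [Algorithm.successProb, ← Nat.card_congr Φ, Nat.card_eq_fintype_card, Fintype.card_prod,
      Nat.cast_mul]
    congr 1
    rw [← finsum_comp_equiv Φ, finsum_eq_sum_of_fintype]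
    exact Finset.sum_congr rfl fun a _ => by rw [hfΦ, hΦ]
  have hcard : (Nat.card 𝒞 : ℝ) = Fintype.card (Fin n → G) := by
    rw [Nat.card_congr C.equivFun.toEquiv, Nat.card_eq_fintype_card]
  have hm : (0 : ℝ) < Fintype.card (Fin m → G) := by exact_mod_cast Fintype.card_pos
  have hn : (0 : ℝ) < Fintype.card (Fin n → G) := by exact_mod_cast Fintype.card_pos
  have hval : 1 / (Nat.card 𝒞 : ℝ) * M = Fintype.card (Fin m → G) * M /
      (Fintype.card (Fin m → G) * Fintype.card (Fin n → G)) := by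
    rw [hcard]
    field_simp
  have hle (alg : Algorithm X K H) :
      alg.successProb query (𝒜 : Set (X → G)) f q ≤ 1 / (Nat.card 𝒞 : ℝ) * M := by
    rw [hsucc, hval]
    gcongr
    exact sum_outputProb_le _ _ he hT alg q hF
  refine ⟨?_, ?_⟩
  · obtain ⟨alg, halg⟩ := exists_le_sum_outputProb (fun l => (B l : X → G))
      (fun j => (C j : X → G)) he hT R q F
    refine ⟨alg, le_antisymm ?_ (hle alg)⟩
    rw [hsucc, hval]
    gcongr
  · rintro p ⟨alg, rfl⟩
    exact hle alg

end Coordinates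

/-- The product of the standard characters of the factors. -/
noncomputable def stdChar {k : ℕ} (N : Fin k → ℕ) [∀ i, NeZero (N i)] :
    AddChar (OracleRange N) ℂ :=
  ∏ i, (ZMod.stdAddChar (N := N i)).compAddMonoidHom (Pi.evalAddMonoidHom _ i)

/-- Test on vectors supported at a coordinate `i` with `a i ≠ 0`: the other factors become `1`,
leaving the primitive character of `ZMod (N i)`. -/
theorem stdChar_isPrimitive {k : ℕ} (N : Fin k → ℕ) [∀ i, NeZero (N i)] :
    (stdChar N).IsPrimitive := by
  intro a ha h
  obtain ⟨i, hi⟩ := Function.ne_iff.1 ha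
  refine ZMod.isPrimitive_stdAddChar (N i) hi ?_
  ext x
  have h1 := DFunLike.congr_fun h (Pi.single i x)
  rw [AddChar.mulShift_apply, stdChar, AddChar.prod_apply, Finset.prod_eq_single i] at h1
  · simpa using h1
  · intro j _ hj
    simp [hj]
  · simp

end QuantumQuery

theorem corollary4p2 {k : ℕ} (N : Fin k → ℕ) [∀ i, NeZero (N i)]
    {X : Type*} [Nonempty X] {H : Type*} [AddGroup H]
    (𝒜 ℬ 𝒞 : Submodule (OracleRange N) (X → OracleRange N))
    (f : 𝒜 →+ H)
    (hker : ∀ A : 𝒜, f A = 0 ↔ (A : X → OracleRange N) ∈ ℬ)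
    (hdisj : Disjoint ℬ 𝒞) (hsup : ℬ ⊔ 𝒞 = 𝒜)
    {m n : ℕ} (B : Module.Basis (Fin m) (OracleRange N) ℬ)
    (C : Module.Basis (Fin n) (OracleRange N) 𝒞) (q : ℕ) :
    IsGreatest
      {p : ℝ | ∃ alg : QuantumQuery.Algorithm X (AddChar (OracleRange N) ℂ) H,
        p = alg.successProb QuantumQuery.phaseQuery (𝒜 : Set (X → OracleRange N)) f q}
      (1 / (Nat.card 𝒞 : ℝ) *
        ((Finset.univ.sup fun h : Fin m → OracleRange N =>
          (QuantumQuery.reachable (fun l => (B l : X → OracleRange N))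
            (fun j => (C j : X → OracleRange N)) q h).ncard : ℕ) : ℝ)) ∧
    IsGreatest
      {p : ℝ | ∃ alg : QuantumQuery.Algorithm X (OracleRange N) H,
        p = alg.successProb QuantumQuery.addQuery (𝒜 : Set (X → OracleRange N)) f q}
      (1 / (Nat.card 𝒞 : ℝ) *
        ((Finset.univ.sup fun h : Fin m → OracleRange N =>
          (QuantumQuery.reachable (fun l => (B l : X → OracleRange N))
            (fun j => (C j : X → OracleRange N)) q h).ncard : ℕ) : ℝ)) := by
  exact ⟨QuantumQuery.isGreatest_successProb (QuantumQuery.stdChar_isPrimitive N)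
      (T := fun _ => LinearIsometryEquiv.refl ℂ _) (fun _ _ _ => rfl) (Equiv.refl _)
      f hker hdisj hsup B C q,
    QuantumQuery.isGreatest_successProb (QuantumQuery.stdChar_isPrimitive N)
      (T := QuantumQuery.responseFourier X _) QuantumQuery.addQuery_responseFourier
      -- Any bijection will do: it only labels the response register at the final measurement.
      (Fintype.equivOfCardEq AddChar.card_eq) f hker hdisj hsup B C q⟩
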